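/- For a squarefree integer $D \ge 2$ let $K = \mathbb{Q}(\sqrt{D})$, let $\mathcal{O}_K$ be its ring of integers, and let $\mathcal{O}_K^+$ be the set of totally positive elements of $\mathcal{O}_K$, that is, of those $\alpha \in \mathcal{O}_K$ for which $\alpha$ and its conjugate are both positive. A partition of $\alpha \in \mathcal{O}_K^+$ is an expression $\alpha = \alpha_1 + \alpha_2 + \dots + \alpha_n$ with $n \ge 1$ and all $\alpha_i \in \mathcal{O}_K^+$, where the order of the summands is irrelevant; let $p_K(\alpha)$ be the number of partitions of $\alpha$. For an integer $m \ge 1$ let $$\mathcal{D}(m) = \{D \in \mathbb{Z}_{\ge 2} \text{ squarefree} : \text{there is no } \alpha \in \mathcal{O}_K^+ \text{ with } p_K(\alpha) = m, \text{ where } K = \mathbb{Q}(\sqrt{D})\}.$$ Then $$\mathcal{D}(1) = \emptyset,\quad \mathcal{D}(2) = \emptyset,\quad \mathcal{D}(3) = \{5\},\quad \mathcal{D}(5) = \{2,3,5\},\quad \mathcal{D}(7) = \{2,5\},\quad \mathcal{D}(11) = \{2,3,5,6,7,13,21\}.$$ -/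

import Mathlib

open scoped NumberField

/-- The real quadratic field `ℚ(√D)`, as a subfield of `ℝ`. -/
noncomputable abbrev RealQuadraticField (D : ℕ) : IntermediateField ℚ ℝ :=
  IntermediateField.adjoin ℚ {Real.sqrt (D : ℝ)}

/-- An algebraic integer of a totally real field `K` is totally positive if
its image under every embedding `K → ℝ` is positive. -/
def TotallyPositive {K : Type*} [Field K] (α : 𝓞 K) : Prop :=
  ∀ σ : K →+* ℝ, 0 < σ (α : K)

/-- The partitions of `α`: the finite multisets (the order of the parts is irrelevant, repetitions
are allowed) of totally positive integers of `K` whose sum is `α`. -/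
def partitionsOf {K : Type*} [Field K] (α : 𝓞 K) : Set (Multiset (𝓞 K)) :=
  {s | (∀ β ∈ s, TotallyPositive β) ∧ s.sum = α}

/-- The partition function `p_K`, with values in `ℕ∞`. -/
noncomputable def partitionFunction {K : Type*} [Field K] (α : 𝓞 K) : ℕ∞ :=
  (partitionsOf α).encard

/-- `𝒟(m)`: the squarefree `D ≥ 2` such that no totally positive integer of `ℚ(√D)` has
exactly `m` partitions. -/
def missingRadicands (m : ℕ) : Set ℕ :=
  {D | 2 ≤ D ∧ Squarefree D ∧
    ¬ ∃ α : 𝓞 (RealQuadraticField D), TotallyPositive α ∧ partitionFunction α = (m : ℕ∞)}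

/-! Identify the ring of integers with `ℤ[ω]`, where `ω` is `√D` or `(1 + √D) / 2`. A positive
rational integer `k` has irrational partitions only if `D` is small compared with `k`: a totally
positive `x + y * ω` with `y ≠ 0` has trace at least about `√D`, or `2√D` when `D % 4 ≠ 1`.
Otherwise `p_K(k)` is the ordinary partition number, and these are 1, 2, 3, 5, 7, 11 for `k = 1,
..., 6`. This settles all but finitely many `D` (`notMem_missingRadicands_of_large`); a few of the
remaining ones are removed by an explicit element.

For an exceptional `D`, `p_K` is invariant under conjugation and under multiplication by totally
positive units, so every element can be moved into a fixed cone (`exists_reduced`). The elements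
needed are `e • b + f • c` with natural `e`, `f` and totally positive `b`, `c`. Adding totally
positive elements never lowers `p_K`, so once `p_K` exceeds 11 it stays above 11, and only finitely
many pairs `(e, f)` have to be checked (`partitionCount_ne_of_cone`). The check uses a verified
recursion for `p_K` (`encard_multisetsWithSum_list`, `partitionCount_eq_computeCount`). -/

/-! ### Counting multisets with a given sum. -/

section Counting

variable {R : Type*} [AddCommGroup R]

/-- The multisets with members in `A` and sum `v`. -/
def multisetsWithSum (A : Set R) (v : R) : Set (Multiset R) :=
  {s | (∀ b ∈ s, b ∈ A) ∧ s.sum = v}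

lemma multisetsWithSum_mono {A B : Set R} (h : A ⊆ B) (v : R) :
    multisetsWithSum A v ⊆ multisetsWithSum B v :=
  fun _ hs => ⟨fun b hb => h (hs.1 b hb), hs.2⟩

lemma multisetsWithSum_empty_zero : multisetsWithSum (∅ : Set R) 0 = {0} := by
  ext s
  constructor
  · rintro ⟨hs, -⟩
    exact Multiset.eq_zero_of_forall_notMem hs
  · rintro rfl
    exact ⟨by simp, by simp⟩

lemma multisetsWithSum_empty_of_ne {v : R} (hv : v ≠ 0) :
    multisetsWithSum (∅ : Set R) v = ∅ := by
  refine Set.eq_empty_of_forall_notMem fun s hs => hv ?_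
  rw [← hs.2, Multiset.eq_zero_of_forall_notMem hs.1, Multiset.sum_zero]

lemma multisetsWithSum_insert (A : Set R) (b v : R) :
    multisetsWithSum (insert b A) v =
      multisetsWithSum A v ∪ (b ::ₘ ·) '' multisetsWithSum (insert b A) (v - b) := by
  ext s
  constructor
  · rintro ⟨hs, rfl⟩
    by_cases hb : b ∈ s
    · obtain ⟨u, rfl⟩ := Multiset.exists_cons_of_mem hb
      exact Or.inr ⟨u, ⟨fun c hc => hs c (Multiset.mem_cons_of_mem hc), by simp⟩, rfl⟩
    · refine Or.inl ⟨fun c hc => (hs c hc).resolve_left ?_, rfl⟩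
      rintro rfl
      exact hb hc
  · rintro (hs | ⟨u, hu, rfl⟩)
    · exact multisetsWithSum_mono (Set.subset_insert b A) v hs
    · refine ⟨fun c hc => ?_, by simp [hu.2]⟩
      rcases Multiset.mem_cons.1 hc with rfl | hc
      · exact Set.mem_insert _ _
      · exact hu.1 c hc

/-- Either `b` is not used, or one copy of it can be removed. -/
lemma encard_multisetsWithSum_insert {A : Set R} {b : R} (hb : b ∉ A) (v : R) :
    (multisetsWithSum (insert b A) v).encard =
      (multisetsWithSum A v).encard + (multisetsWithSum (insert b A) (v - b)).encard := by
  have hinj : Function.Injective (b ::ₘ · : Multiset R → Multiset R) :=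
    fun _ _ h => (Multiset.cons_inj_right b).1 h
  rw [multisetsWithSum_insert, Set.encard_union_eq, hinj.encard_image]
  rw [Set.disjoint_left]
  rintro _ hs ⟨u, -, rfl⟩
  exact hb (hs.1 b (Multiset.mem_cons_self b u))

lemma map_sum_nonneg (T : R →+ ℤ) {s : Multiset R} (hs : ∀ b ∈ s, 0 < T b) : 0 ≤ T s.sum := by
  rw [map_multiset_sum]
  refine Multiset.sum_nonneg fun x hx => ?_
  obtain ⟨b, hb, rfl⟩ := Multiset.mem_map.1 hx
  exact (hs b hb).le

/-- Counts, within a given recursion depth, the multisets with members in a list and given sum.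
Branches whose remaining sum violates `good` are cut off. -/
def countSums [DecidableEq R] (good : R → Bool) : ℕ → List R → R → ℕ
  | _, [], v => if v = 0 then 1 else 0
  | 0, _ :: _, _ => 0
  | k + 1, b :: L, v =>
    countSums good k L v + bif good (v - b) then countSums good k (b :: L) (v - b) else 0

/-- Each recursive call either shortens the list or lowers `T v` by at least 1, so `L.length + T v`
bounds the depth. Sums of listed members have `T ≥ 0`, which makes the value 0 correct when the
depth is exhausted. Pruning loses nothing, as every attainable sum is `good`. -/
lemma encard_multisetsWithSum_list [DecidableEq R] (good : R → Bool) (T : R →+ ℤ)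
    (k : ℕ) (L : List R) (v : R) (hL : L.Nodup) (hT : ∀ b ∈ L, 0 < T b)
    (hgood : ∀ s : Multiset R, (∀ b ∈ s, b ∈ L) → good s.sum) (hk : (L.length : ℤ) + T v ≤ k) :
    (multisetsWithSum {b | b ∈ L} v).encard = countSums good k L v := by
  induction k generalizing L v with
  | zero =>
    cases L with
    | nil =>
      simp only [List.not_mem_nil, Set.ofPred_false, countSums]
      split_ifs with h
      · rw [h, multisetsWithSum_empty_zero]; simp
      · rw [multisetsWithSum_empty_of_ne h]; simp
    | cons b L =>
      rw [countSums, Nat.cast_zero, Set.encard_eq_zero]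
      refine Set.eq_empty_of_forall_notMem fun s hs => ?_
      have := map_sum_nonneg T fun c hc => hT c (hs.1 c hc)
      rw [hs.2] at this
      simp only [List.length_cons] at hk
      push_cast at hk
      omega
  | succ k ih =>
    cases L with
    | nil =>
      simp only [List.not_mem_nil, Set.ofPred_false, countSums]
      split_ifs with h
      · rw [h, multisetsWithSum_empty_zero]; simp
      · rw [multisetsWithSum_empty_of_ne h]; simp
    | cons b L =>
      have hset : {c | c ∈ b :: L} = insert b {c | c ∈ L} := by ext c; simp
      have hb : b ∉ {c | c ∈ L} := (List.nodup_cons.1 hL).1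
      have hTb := hT b List.mem_cons_self
      simp only [List.length_cons] at hk
      push_cast at hk
      rw [hset, encard_multisetsWithSum_insert hb, ← hset, countSums, Nat.cast_add,
        ih L v (List.nodup_cons.1 hL).2 (fun c hc => hT c (List.mem_cons_of_mem _ hc))
          (fun s hs => hgood s fun c hc => List.mem_cons_of_mem _ (hs c hc)) (by omega)]
      congr 1
      cases hg : good (v - b) with
      | true =>
        rw [cond_true]
        refine ih _ _ hL hT hgood ?_
        rw [map_sub, List.length_cons]
        push_cast
        omega
      | false =>
        rw [cond_false, Nat.cast_zero, Set.encard_eq_zero]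
        refine Set.eq_empty_of_forall_notMem fun s hs => ?_
        have := hgood s hs.1
        rw [hs.2, hg] at this
        exact Bool.noConfusion this

/-- Appending the fixed multiset `u` is injective. This is the source of the monotonicity of `p_K`.
-/
lemma multisetsWithSum_add_encard_le {A : Set R} (v : R) (u : Multiset R) (hu : ∀ b ∈ u, b ∈ A) :
    (multisetsWithSum A v).encard ≤ (multisetsWithSum A (v + u.sum)).encard := by
  refine Set.encard_le_encard_of_injOn (f := (· + u)) ?_ (add_left_injective u).injOn
  rintro s ⟨hs, rfl⟩
  refine ⟨fun b hb => ?_, Multiset.sum_add _ _⟩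
  rcases Multiset.mem_add.1 hb with hb | hb
  · exact hs b hb
  · exact hu b hb

lemma encard_multisetsWithSum_map {R' : Type*} [AddCommGroup R'] (f : R →+ R')
    (hf : Function.Bijective f) {A : Set R} {A' : Set R'} (hA : ∀ b, f b ∈ A' ↔ b ∈ A) (v : R) :
    (multisetsWithSum A' (f v)).encard = (multisetsWithSum A v).encard := by
  have : multisetsWithSum A' (f v) = Multiset.map f '' multisetsWithSum A v := by
    ext s
    constructor
    · rintro ⟨hs, hv⟩
      obtain ⟨u, rfl⟩ := Multiset.map_surjective_of_surjective hf.2 s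
      refine ⟨u, ⟨fun b hb => (hA b).1 (hs _ (Multiset.mem_map_of_mem f hb)), hf.1 ?_⟩, rfl⟩
      rw [← hv, map_multiset_sum]
    · rintro ⟨u, ⟨hu, rfl⟩, rfl⟩
      refine ⟨fun b hb => ?_, (map_multiset_sum f u).symm⟩
      obtain ⟨c, hc, rfl⟩ := Multiset.mem_map.1 hb
      exact (hA c).2 (hu c hc)
  rw [this, (Multiset.map_injective hf.1).encard_image]

end Counting

/-! ### Total positivity and a computable partition count in `ℤ[ω]`. -/

section QuadraticOrder

open QuadraticAlgebra

variable {n t : ℤ}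

/-- Total positivity in `ℤ[ω]`, where `ω ^ 2 = n + t * ω`, in terms of trace and norm. -/
def IsPos (v : QuadraticAlgebra ℤ n t) : Prop := 0 < trace v ∧ 0 < norm v

lemma isPos_iff (v : QuadraticAlgebra ℤ n t) :
    IsPos v ↔ 0 < 2 * v.re + t * v.im ∧
      0 < v.re * v.re + t * v.re * v.im - n * v.im * v.im := Iff.rfl

instance (v : QuadraticAlgebra ℤ n t) : Decidable (IsPos v) :=
  decidable_of_iff' _ (isPos_iff v)

/-- The number of partitions of `v` into totally positive elements of `ℤ[ω]`. -/
noncomputable def partitionCount (v : QuadraticAlgebra ℤ n t) : ℕ∞ :=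
  (multisetsWithSum {b | IsPos b} v).encard

lemma trace_sq_sub (v : QuadraticAlgebra ℤ n t) :
    trace v ^ 2 - (t ^ 2 + 4 * n) * v.im ^ 2 = 4 * norm v := by
  rw [trace_def, norm_def]; ring

lemma trace_mul_eq (v w : QuadraticAlgebra ℤ n t) :
    2 * trace (v * w) = trace v * trace w + (t ^ 2 + 4 * n) * (v.im * w.im) := by
  simp only [trace_def, re_mul, im_mul]; ring

/-- With `Δ = t ^ 2 + 4 * n`, positivity means `√Δ * |im| < trace`; multiplying the two bounds gives
the claim. Applied to `v, w` it controls the trace of a product, and applied to `v, star w` the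
cross term in the norm of a sum. -/
lemma trace_mul_pos (hD : 0 < t ^ 2 + 4 * n) {v w : QuadraticAlgebra ℤ n t} (hv : IsPos v)
    (hw : IsPos w) : 0 < trace v * trace w + (t ^ 2 + 4 * n) * (v.im * w.im) := by
  have h1 := trace_sq_sub v
  have h2 := trace_sq_sub w
  have hv2 := hv.2
  have hw2 := hw.2
  have hlt : ((t ^ 2 + 4 * n) * (v.im * w.im)) ^ 2 < (trace v * trace w) ^ 2 := by
    have e1 : (t ^ 2 + 4 * n) * v.im ^ 2 < trace v ^ 2 := by linarith
    have e2 : (t ^ 2 + 4 * n) * w.im ^ 2 < trace w ^ 2 := by linarith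
    calc ((t ^ 2 + 4 * n) * (v.im * w.im)) ^ 2
        = ((t ^ 2 + 4 * n) * v.im ^ 2) * ((t ^ 2 + 4 * n) * w.im ^ 2) := by ring
      _ < trace v ^ 2 * trace w ^ 2 := mul_lt_mul'' e1 e2 (by positivity) (by positivity)
      _ = _ := by ring
  have := (abs_lt.1 (abs_lt_of_sq_lt_sq hlt (mul_pos hv.1 hw.1).le)).1
  linarith

lemma IsPos.mul (hD : 0 < t ^ 2 + 4 * n) {v w : QuadraticAlgebra ℤ n t} (hv : IsPos v)
    (hw : IsPos w) : IsPos (v * w) := by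
  refine ⟨?_, by rw [map_mul]; exact mul_pos hv.2 hw.2⟩
  have := trace_mul_pos hD hv hw
  rw [← trace_mul_eq] at this
  linarith

lemma norm_add_eq (v w : QuadraticAlgebra ℤ n t) :
    2 * norm (v + w) = 2 * norm v + 2 * norm w +
      (trace v * trace (star w) + (t ^ 2 + 4 * n) * (v.im * (star w).im)) := by
  simp only [trace_def, norm_def, re_add, im_add, re_star, im_star]; ring

lemma IsPos.star {v : QuadraticAlgebra ℤ n t} (hv : IsPos v) : IsPos (star v) :=
  ⟨by rw [trace_star]; exact hv.1, by rw [QuadraticAlgebra.norm_star]; exact hv.2⟩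

lemma isPos_star {v : QuadraticAlgebra ℤ n t} : IsPos (Star.star v) ↔ IsPos v :=
  ⟨fun h => by simpa using h.star, IsPos.star⟩

lemma IsPos.add (hD : 0 < t ^ 2 + 4 * n) {v w : QuadraticAlgebra ℤ n t} (hv : IsPos v)
    (hw : IsPos w) : IsPos (v + w) := by
  refine ⟨by rw [map_add]; exact add_pos hv.1 hw.1, ?_⟩
  have := trace_mul_pos hD hv hw.star
  have h := norm_add_eq v w
  have hv2 := hv.2
  have hw2 := hw.2
  linarith

lemma sum_eq_zero_or_isPos (hD : 0 < t ^ 2 + 4 * n) (s : Multiset (QuadraticAlgebra ℤ n t))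
    (hs : ∀ b ∈ s, IsPos b) : s.sum = 0 ∨ IsPos s.sum := by
  induction s using Multiset.induction_on with
  | empty => exact Or.inl rfl
  | cons a s ih =>
    right
    rw [Multiset.sum_cons]
    rcases ih fun b hb => hs b (Multiset.mem_cons_of_mem hb) with h | h
    · rw [h, add_zero]
      exact hs a (Multiset.mem_cons_self a s)
    · exact (hs a (Multiset.mem_cons_self a s)).add hD h

/-- The partition count is determined by any list containing all possible parts. -/
lemma partitionCount_eq_countSums (hD : 0 < t ^ 2 + 4 * n) (v : QuadraticAlgebra ℤ n t)
    (L : List (QuadraticAlgebra ℤ n t)) (hL : L.Nodup) (hpos : ∀ b ∈ L, IsPos b)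
    (hmem : ∀ b, IsPos b → v - b = 0 ∨ IsPos (v - b) → b ∈ L)
    (good : QuadraticAlgebra ℤ n t → Bool) (hgood : ∀ u, u = 0 ∨ IsPos u → good u)
    (k : ℕ) (hk : (L.length : ℤ) + trace v ≤ k) :
    partitionCount v = countSums good k L v := by
  have hset : multisetsWithSum {b : QuadraticAlgebra ℤ n t | IsPos b} v =
      multisetsWithSum {b | b ∈ L} v := by
    refine Set.Subset.antisymm ?_ (multisetsWithSum_mono (fun b hb => hpos b hb) v)
    rintro s ⟨hs, rfl⟩
    refine ⟨fun b hb => ?_, rfl⟩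
    obtain ⟨u, rfl⟩ := Multiset.exists_cons_of_mem hb
    refine hmem b (hs b hb) ?_
    rw [Multiset.sum_cons, add_sub_cancel_left]
    exact sum_eq_zero_or_isPos hD u fun c hc => hs c (Multiset.mem_cons_of_mem hc)
  rw [partitionCount, hset]
  exact encard_multisetsWithSum_list good trace.toAddMonoidHom k L v hL
    (fun b hb => (hpos b hb).1)
    (fun s hs => hgood _ (sum_eq_zero_or_isPos hD s fun b hb => hpos b (hs b hb))) hk

lemma IsPos.re_pos (hn : 0 < n) {v : QuadraticAlgebra ℤ n t} (hv : IsPos v) : 0 < v.re := by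
  obtain ⟨h1, h2⟩ := (isPos_iff v).1 hv
  by_contra! h
  have h3 : 0 < v.re + t * v.im := by linarith
  nlinarith [mul_nonneg (neg_nonneg.2 h) h3.le, mul_nonneg hn.le (sq_nonneg v.im)]

/-- A crude bound, uniform in `n ≥ 1`, which makes the search for possible parts finite. -/
lemma IsPos.abs_im_le (hn : 0 < n) (ht : t = 0 ∨ t = 1) {v : QuadraticAlgebra ℤ n t}
    (hv : IsPos v) : |v.im| ≤ 2 * v.re := by
  have h0 := hv.re_pos hn
  have h2 := ((isPos_iff v).1 hv).2
  have h3 : v.im ^ 2 < v.re ^ 2 + t * v.re * v.im := by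
    nlinarith [mul_nonneg (show 0 ≤ n - 1 by linarith) (sq_nonneg v.im)]
  rw [abs_le]
  constructor <;> by_contra! h <;> rcases ht with rfl | rfl <;> nlinarith

/-- The elements `x + y * ω` with `0 < x ≤ m` and `|y| ≤ 2 * x`. -/
def box (n t : ℤ) (m : ℕ) : List (QuadraticAlgebra ℤ n t) :=
  (List.range m).flatMap fun i : ℕ =>
    (List.range (4 * i + 5)).map fun j : ℕ => ⟨(i : ℤ) + 1, (j : ℤ) - 2 * (i + 1)⟩

lemma nodup_box (n t : ℤ) (m : ℕ) : (box n t m).Nodup := by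
  rw [box, List.nodup_flatMap]
  refine ⟨fun i _ => List.nodup_range.map fun j k h => ?_, ?_⟩
  · have := congrArg QuadraticAlgebra.im h
    simp only at this
    omega
  · refine List.nodup_range.imp fun {i k} hik => ?_
    rw [Function.onFun, List.disjoint_left]
    intro b hb hb'
    obtain ⟨j, -, rfl⟩ := List.mem_map.1 hb
    obtain ⟨l, -, h⟩ := List.mem_map.1 hb'
    have := congrArg QuadraticAlgebra.re h
    simp only at this
    omega

lemma mem_box {m : ℕ} {b : QuadraticAlgebra ℤ n t} (h0 : 0 < b.re) (hre : b.re ≤ m)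
    (him : |b.im| ≤ 2 * b.re) : b ∈ box n t m := by
  rw [abs_le] at him
  refine List.mem_flatMap.2 ⟨(b.re - 1).toNat, List.mem_range.2 (by omega),
    List.mem_map.2 ⟨(b.im + 2 * b.re).toNat, List.mem_range.2 (by omega), ?_⟩⟩
  ext <;> simp only <;> omega

/-- The possible parts of a partition of `v`. -/
def possibleParts (v : QuadraticAlgebra ℤ n t) : List (QuadraticAlgebra ℤ n t) :=
  (box n t v.re.toNat).filter fun b => IsPos b ∧ (v - b = 0 ∨ IsPos (v - b))

/-- A computable form of `partitionCount`. -/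
def computeCount (v : QuadraticAlgebra ℤ n t) : ℕ :=
  countSums (fun u => decide (u = 0 ∨ IsPos u))
    ((possibleParts v).length + (2 * v.re + t * v.im).toNat) (possibleParts v) v

lemma partitionCount_eq_computeCount (hn : 0 < n) (ht : t = 0 ∨ t = 1)
    (v : QuadraticAlgebra ℤ n t) : partitionCount v = computeCount v := by
  have hD : 0 < t ^ 2 + 4 * n := by positivity
  refine partitionCount_eq_countSums hD v _ ((nodup_box _ _ _).filter _) ?_ ?_ _ (by simp) _ ?_
  · intro b hb
    have := (List.mem_filter.1 hb).2
    simp only [decide_eq_true_eq] at this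
    exact this.1
  · intro b hb hvb
    refine List.mem_filter.2 ⟨?_, by simpa using ⟨hb, hvb⟩⟩
    have hre : 0 ≤ (v - b).re := by
      rcases hvb with h | h
      · rw [h]; simp
      · exact (h.re_pos hn).le
    rw [re_sub] at hre
    exact mem_box (hb.re_pos hn) (by omega) (hb.abs_im_le hn ht)
  · rw [← trace_def, Nat.cast_add]
    exact add_le_add_right (Int.self_le_toNat _) _

lemma partitionCount_le_add (v : QuadraticAlgebra ℤ n t) {b c : QuadraticAlgebra ℤ n t}
    (hb : IsPos b) (hc : IsPos c) (e f : ℕ) :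
    partitionCount v ≤ partitionCount (v + (e • b + f • c)) := by
  have := multisetsWithSum_add_encard_le (A := {b : QuadraticAlgebra ℤ n t | IsPos b}) v
    (Multiset.replicate e b + Multiset.replicate f c) (by
      intro x hx
      rcases Multiset.mem_add.1 hx with h | h
      · rwa [Multiset.eq_of_mem_replicate h]
      · rwa [Multiset.eq_of_mem_replicate h])
  simpa [partitionCount] using this

lemma partitionCount_star (v : QuadraticAlgebra ℤ n t) :
    partitionCount (star v) = partitionCount v :=
  encard_multisetsWithSum_map (starAddEquiv : QuadraticAlgebra ℤ n t ≃+ _).toAddMonoidHom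
    (starAddEquiv : QuadraticAlgebra ℤ n t ≃+ _).bijective (fun _ => isPos_star) v

lemma partitionCount_mul (hD : 0 < t ^ 2 + 4 * n) {u w : QuadraticAlgebra ℤ n t} (hu : IsPos u)
    (hw : IsPos w) (huw : u * w = 1) (v : QuadraticAlgebra ℤ n t) :
    partitionCount (u * v) = partitionCount v := by
  refine encard_multisetsWithSum_map (AddMonoidHom.mulLeft u) ⟨?_, fun x => ⟨w * x, ?_⟩⟩
    (fun b => ⟨fun h => ?_, fun h => hu.mul hD h⟩) v
  · intro x y h
    have := congrArg (w * ·) h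
    simpa [← mul_assoc, mul_comm w u, huw] using this
  · simp [← mul_assoc, huw]
  · have : IsPos (w * (u * b)) := hw.mul hD h
    change IsPos b
    simpa [← mul_assoc, mul_comm w u, huw] using this

end QuadraticOrder

/-! ### Rational integers with only rational partitions. -/

section Rational

open QuadraticAlgebra

variable {n t : ℤ}

/-- The positive rational integers up to `k`. -/
def rationalParts (n t : ℤ) (k : ℕ) : List (QuadraticAlgebra ℤ n t) :=
  (List.range k).map fun i : ℕ => ⟨(i : ℤ) + 1, 0⟩

/-- The depth `3 * k` is the sum of the list length `k` and the trace `2 * k`. -/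
lemma partitionCount_rational (hn : 0 < n) (k : ℕ)
    (h : ∀ b : QuadraticAlgebra ℤ n t, IsPos b → IsPos (⟨k, 0⟩ - b) → b.im = 0) :
    partitionCount (⟨k, 0⟩ : QuadraticAlgebra ℤ n t) =
      countSums (fun u => decide (0 ≤ u.re)) (3 * k) (rationalParts n t k) ⟨k, 0⟩ := by
  have hD : 0 < t ^ 2 + 4 * n := by positivity
  refine partitionCount_eq_countSums hD _ _ ?_ ?_ ?_ _ ?_ _ ?_
  · refine List.nodup_range.map fun i j hij => ?_
    have := congrArg QuadraticAlgebra.re hij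
    simp only at this
    omega
  · intro b hb
    obtain ⟨i, -, rfl⟩ := List.mem_map.1 hb
    rw [isPos_iff]
    constructor
    · simp only; omega
    · simp only; nlinarith
  · intro b hb hkb
    have him : b.im = 0 := by
      rcases hkb with hkb | hkb
      · have := congrArg QuadraticAlgebra.im hkb
        simpa using this
      · exact h b hb hkb
    have h0 := hb.re_pos hn
    have hk : b.re ≤ k := by
      have : 0 ≤ ((⟨k, 0⟩ : QuadraticAlgebra ℤ n t) - b).re := by
        rcases hkb with hkb | hkb
        · rw [hkb]; simp
        · exact (hkb.re_pos hn).le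
      simpa using this
    refine List.mem_map.2 ⟨(b.re - 1).toNat, List.mem_range.2 (by omega), ?_⟩
    ext
    · simp only; omega
    · simp only [him]
  · rintro u (rfl | hu)
    · simp
    · simpa using (hu.re_pos hn).le
  · simp only [rationalParts, List.length_map, List.length_range, trace_def]
    push_cast
    linarith

/-- If `im ≠ 0`, positivity of the norm gives `re ^ 2 > n ≥ c ^ 2`. Both `b` and its complement
would then have `re ≥ c + 1`, forcing `k ≥ 2 * c + 2`. -/
lemma im_eq_zero_of_isPos_sub_zero {c : ℤ} (hc : 0 < c) (hcn : c ^ 2 ≤ n) {k : ℕ}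
    (hk : k ≤ 2 * c + 1) (b : QuadraticAlgebra ℤ n 0) (hb : IsPos b)
    (hkb : IsPos (⟨k, 0⟩ - b)) : b.im = 0 := by
  by_contra him
  have key : ∀ a : QuadraticAlgebra ℤ n 0, IsPos a → a.im ≠ 0 → c + 1 ≤ a.re := by
    intro a ha ha0
    obtain ⟨h1, h2⟩ := (isPos_iff a).1 ha
    have : 1 ≤ a.im ^ 2 := Int.one_le_abs (pow_ne_zero 2 ha0) |>.trans_eq (abs_sq _)
    nlinarith
  have h1 := key b hb him
  have h2 := key _ hkb (by simpa using him)
  rw [re_sub] at h2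
  linarith

/-- If `im ≠ 0`, then `trace > c * |im|`. For `|im| = 1` the trace is odd like `c`, hence at least
`c + 2`; for `|im| ≥ 2` the same bound is immediate. Two such traces add up to more than `2 * k`. -/
lemma im_eq_zero_of_isPos_sub_one {c : ℤ} (hc : 0 < c) (hodd : Odd c) (hcn : c ^ 2 ≤ 1 + 4 * n)
    {k : ℕ} (hk : k ≤ c + 1) (b : QuadraticAlgebra ℤ n 1) (hb : IsPos b)
    (hkb : IsPos (⟨k, 0⟩ - b)) : b.im = 0 := by
  by_contra him
  have key : ∀ a : QuadraticAlgebra ℤ n 1, IsPos a → a.im ≠ 0 → c + 2 ≤ 2 * a.re + a.im := by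
    intro a ha ha0
    have hsq := trace_sq_sub a
    have h2 := ha.2
    have h1 := ha.1
    rw [trace_def, one_mul] at hsq h1
    have hlt : c ^ 2 * a.im ^ 2 < (2 * a.re + a.im) ^ 2 := by
      nlinarith [mul_le_mul_of_nonneg_right hcn (sq_nonneg a.im)]
    have hlt' : c * |a.im| < 2 * a.re + a.im := by
      refine lt_of_pow_lt_pow_left₀ 2 h1.le ?_
      rwa [mul_pow, sq_abs]
    have hpos : 1 ≤ |a.im| := Int.one_le_abs ha0
    rcases hpos.lt_or_eq with h | h
    · nlinarith
    · rw [← h, mul_one] at hlt'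
      obtain ⟨d, rfl⟩ := hodd
      rcases abs_eq (zero_le_one' ℤ) |>.1 h.symm with h' | h' <;> rw [h'] at hlt' ⊢ <;> omega
  have h1 := key b hb him
  have h2 := key _ hkb (by simpa using him)
  rw [re_sub, im_sub] at h2
  simp only at h2
  linarith

lemma countSums_rationalParts (n t : ℤ) :
    ∀ q ∈ [(1, 1), (2, 2), (3, 3), (4, 5), (5, 7), (6, 11)],
      countSums (fun u => decide (0 ≤ u.re)) (3 * q.1) (rationalParts n t q.1) ⟨(q.1 : ℕ), 0⟩
        = q.2 := by
  simp only [List.forall_mem_cons, List.not_mem_nil, false_imp_iff, implies_true, and_true]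
  refine ⟨rfl, rfl, rfl, rfl, rfl, rfl⟩

end Rational

/-! ### Exceptional radicands: reduction to a cone and a finite check. -/

section Exceptional

open QuadraticAlgebra

variable {n t : ℤ}

/-- Multiplying by units and conjugating brings every totally positive element into
the cone of elements whose trace does not drop under multiplication by a given unit. -/
lemma exists_reduced (hD : 0 < t ^ 2 + 4 * n) {u w : QuadraticAlgebra ℤ n t} (hu : IsPos u)
    (hw : IsPos w) (huw : u * w = 1) (v : QuadraticAlgebra ℤ n t) (hv : IsPos v) :
    ∃ v', IsPos v' ∧ 0 ≤ v'.im ∧ trace v' ≤ trace (u * v') ∧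
      partitionCount v' = partitionCount v := by
  -- Conjugation keeps the trace and makes `im` nonnegative. If multiplication by `u` then lowers
  -- the trace, repeat; the trace stays a positive integer, so this ends.
  induction hk : (trace v).toNat using Nat.strong_induction_on generalizing v with
  | _ k ih =>
    have main : ∀ x : QuadraticAlgebra ℤ n t, IsPos x → 0 ≤ x.im → trace x = trace v →
        partitionCount x = partitionCount v → ∃ v', IsPos v' ∧ 0 ≤ v'.im ∧
          trace v' ≤ trace (u * v') ∧ partitionCount v' = partitionCount v := by
      intro x hx him htr hp
      by_cases h : trace x ≤ trace (u * x)
      · exact ⟨x, hx, him, h, hp⟩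
      · have hux := hu.mul hD hx
        have h1 := hux.1
        obtain ⟨v', h1, h2, h3, h4⟩ := ih _ (by omega) (u * x) hux rfl
        exact ⟨v', h1, h2, h3, by rw [h4, partitionCount_mul hD hu hw huw, hp]⟩
    rcases le_total 0 v.im with h | h
    · exact main v hv h rfl rfl
    · exact main (star v) hv.star (by simpa using h) (trace_star v) (partitionCount_star v)

/-- The combination of two elements with natural coefficients, in coordinates. -/
def combination (b c : QuadraticAlgebra ℤ n t) (q : ℕ × ℕ) : QuadraticAlgebra ℤ n t :=
  ⟨q.1 * b.re + q.2 * c.re, q.1 * b.im + q.2 * c.im⟩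

lemma combination_eq (b c : QuadraticAlgebra ℤ n t) (q : ℕ × ℕ) :
    combination b c q = q.1 • b + q.2 • c := by
  ext <;> simp [combination]

/-- The pairs `(E, 0)`, `(0, F)` and those in `large` have counts above 11, and so has every pair
dominating one of them coordinatewise. The nonzero pairs left over lie in a finite box and are
computed. -/
lemma partitionCount_ne_of_cone (hn : 0 < n) (ht : t = 0 ∨ t = 1) {b c : QuadraticAlgebra ℤ n t}
    (hb : IsPos b) (hc : IsPos c) (M : List ℕ) (hM : ∀ m ∈ M, m ≤ 11) (E F : ℕ)
    (large : List (ℕ × ℕ))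
    (hlarge : ∀ q ∈ (E, 0) :: (0, F) :: large, 11 < computeCount (combination b c q))
    (hsmall : ∀ e < E, ∀ f < F, (e = 0 ∧ f = 0) ∨ (∃ q ∈ large, q.1 ≤ e ∧ q.2 ≤ f) ∨
      computeCount (combination b c (e, f)) ∉ M)
    (q : ℕ × ℕ) (hq : q ≠ 0) (m : ℕ) (hm : m ∈ M) :
    partitionCount (combination b c q) ≠ m := by
  have hbig : ∀ r ∈ (E, 0) :: (0, F) :: large, r.1 ≤ q.1 → r.2 ≤ q.2 →
      partitionCount (combination b c q) ≠ m := by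
    intro r hr h1 h2 h
    have hle := partitionCount_le_add (combination b c r) hb hc (q.1 - r.1) (q.2 - r.2)
    have heq : combination b c r + ((q.1 - r.1) • b + (q.2 - r.2) • c) = combination b c q := by
      rw [combination_eq, combination_eq, add_add_add_comm, ← add_nsmul, ← add_nsmul,
        Nat.add_sub_cancel' h1, Nat.add_sub_cancel' h2]
    rw [heq, h, partitionCount_eq_computeCount hn ht, Nat.cast_le] at hle
    have := hlarge r hr
    have := hM m hm
    omega
  rcases le_or_gt E q.1 with hE | hE
  · exact hbig (E, 0) (by simp) hE (Nat.zero_le _)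
  rcases le_or_gt F q.2 with hF | hF
  · exact hbig (0, F) (by simp) (Nat.zero_le _) hF
  rcases hsmall q.1 hE q.2 hF with h | ⟨r, hr, h1, h2⟩ | h
  · exact absurd (Prod.ext h.1 h.2) hq
  · exact hbig r (by simp [hr]) h1 h2
  · intro h'
    rw [partitionCount_eq_computeCount hn ht, Nat.cast_inj] at h'
    exact h (h' ▸ hm)

lemma partitionCount_ne_two (v : QuadraticAlgebra ℤ 2 0) (hv : IsPos v) :
    ∀ m ∈ ([5, 7, 11] : List ℕ), partitionCount v ≠ m := by
  intro m hm
  obtain ⟨w, hw, him, htr, hp⟩ := exists_reduced (by norm_num)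
    (show IsPos (⟨3, -2⟩ : QuadraticAlgebra ℤ 2 0) by decide)
    (show IsPos (⟨3, 2⟩ : QuadraticAlgebra ℤ 2 0) by decide) (by decide) v hv
  have h0 := hw.1
  simp only [trace_def, re_mul, im_mul] at htr h0
  -- Here `htr` amounts to `w.re ≥ 2 * w.im`, and `1`, `2 + √2` form a `ℤ`-basis spanning exactly
  -- this cone.
  have hc : w = combination ⟨1, 0⟩ ⟨2, 1⟩ ((w.re - 2 * w.im).toNat, w.im.toNat) := by
    ext <;> simp only [combination] <;> omega
  rw [← hp, hc]
  refine partitionCount_ne_of_cone (by norm_num) (by norm_num) (by decide) (by decide)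
    [5, 7, 11] (by decide) 6 4 [(1, 3), (2, 2), (4, 1)] (by decide +kernel) (by decide +kernel)
    _ ?_ m hm
  simp only [ne_eq, Prod.mk_eq_zero]
  omega

lemma partitionCount_ne_three (v : QuadraticAlgebra ℤ 3 0) (hv : IsPos v) :
    ∀ m ∈ ([5, 11] : List ℕ), partitionCount v ≠ m := by
  intro m hm
  obtain ⟨w, hw, him, htr, hp⟩ := exists_reduced (by norm_num)
    (show IsPos (⟨2, -1⟩ : QuadraticAlgebra ℤ 3 0) by decide)
    (show IsPos (⟨2, 1⟩ : QuadraticAlgebra ℤ 3 0) by decide) (by decide) v hv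
  have h0 := hw.1
  simp only [trace_def, re_mul, im_mul] at htr h0
  have hc : w = combination ⟨1, 0⟩ ⟨2, 1⟩ ((w.re - 2 * w.im).toNat, w.im.toNat) := by
    -- The reduced cone is `re ≥ 3 * im`; the larger cone spanned by the basis `1`, `2 + √3`
    -- suffices.
    ext <;> simp only [combination] <;> omega
  rw [← hp, hc]
  refine partitionCount_ne_of_cone (by norm_num) (by norm_num) (by decide) (by decide)
    [5, 11] (by decide) 6 6 [(1, 4), (2, 3), (3, 2), (4, 1)] (by decide +kernel)
    (by decide +kernel) _ ?_ m hm
  simp only [ne_eq, Prod.mk_eq_zero]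
  omega

lemma partitionCount_ne_five (v : QuadraticAlgebra ℤ 1 1) (hv : IsPos v) :
    ∀ m ∈ ([3, 5, 7, 11] : List ℕ), partitionCount v ≠ m := by
  intro m hm
  obtain ⟨w, hw, him, htr, hp⟩ := exists_reduced (by norm_num)
    (show IsPos (⟨2, -1⟩ : QuadraticAlgebra ℤ 1 1) by decide)
    (show IsPos (⟨1, 1⟩ : QuadraticAlgebra ℤ 1 1) by decide) (by decide) v hv
  have h0 := hw.1
  simp only [trace_def, re_mul, im_mul] at htr h0
  have hc : w = combination ⟨1, 0⟩ ⟨1, 1⟩ ((w.re - w.im).toNat, w.im.toNat) := by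
    ext <;> simp only [combination] <;> omega
  rw [← hp, hc]
  refine partitionCount_ne_of_cone (by norm_num) (by norm_num) (by decide) (by decide)
    [3, 5, 7, 11] (by decide) 5 5 [(1, 4), (2, 3), (3, 2), (4, 1)] (by decide +kernel)
    (by decide +kernel) _ ?_ m hm
  simp only [ne_eq, Prod.mk_eq_zero]
  omega

lemma partitionCount_ne_six (v : QuadraticAlgebra ℤ 6 0) (hv : IsPos v) :
    ∀ m ∈ ([11] : List ℕ), partitionCount v ≠ m := by
  intro m hm
  obtain ⟨w, hw, him, htr, hp⟩ := exists_reduced (by norm_num)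
    (show IsPos (⟨5, -2⟩ : QuadraticAlgebra ℤ 6 0) by decide)
    (show IsPos (⟨5, 2⟩ : QuadraticAlgebra ℤ 6 0) by decide) (by decide) v hv
  have h0 := hw.1
  simp only [trace_def, re_mul, im_mul] at htr h0
  have hc : w = combination ⟨1, 0⟩ ⟨3, 1⟩ ((w.re - 3 * w.im).toNat, w.im.toNat) := by
    ext <;> simp only [combination] <;> omega
  rw [← hp, hc]
  refine partitionCount_ne_of_cone (by norm_num) (by norm_num) (by decide) (by decide)
    [11] (by decide) 6 4 [(1, 3), (2, 2), (4, 1)] (by decide +kernel) (by decide +kernel)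
    _ ?_ m hm
  simp only [ne_eq, Prod.mk_eq_zero]
  omega

lemma partitionCount_ne_seven (v : QuadraticAlgebra ℤ 7 0) (hv : IsPos v) :
    ∀ m ∈ ([11] : List ℕ), partitionCount v ≠ m := by
  intro m hm
  obtain ⟨w, hw, him, htr, hp⟩ := exists_reduced (by norm_num)
    (show IsPos (⟨8, -3⟩ : QuadraticAlgebra ℤ 7 0) by decide)
    (show IsPos (⟨8, 3⟩ : QuadraticAlgebra ℤ 7 0) by decide) (by decide) v hv
  have h0 := hw.1
  simp only [trace_def, re_mul, im_mul] at htr h0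
  have hc : w = combination ⟨1, 0⟩ ⟨3, 1⟩ ((w.re - 3 * w.im).toNat, w.im.toNat) := by
    ext <;> simp only [combination] <;> omega
  rw [← hp, hc]
  refine partitionCount_ne_of_cone (by norm_num) (by norm_num) (by decide) (by decide)
    [11] (by decide) 6 5 [(1, 4), (2, 3), (3, 2), (4, 1)] (by decide +kernel)
    (by decide +kernel) _ ?_ m hm
  simp only [ne_eq, Prod.mk_eq_zero]
  omega

lemma partitionCount_ne_thirteen (v : QuadraticAlgebra ℤ 3 1) (hv : IsPos v) :
    ∀ m ∈ ([11] : List ℕ), partitionCount v ≠ m := by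
  intro m hm
  obtain ⟨w, hw, him, htr, hp⟩ := exists_reduced (by norm_num)
    (show IsPos (⟨7, -3⟩ : QuadraticAlgebra ℤ 3 1) by decide)
    (show IsPos (⟨4, 3⟩ : QuadraticAlgebra ℤ 3 1) by decide) (by decide) v hv
  have h0 := hw.1
  simp only [trace_def, re_mul, im_mul] at htr h0
  rw [← hp]
  -- The reduced cone is `3 * re ≥ 5 * im ≥ 0`. It is covered by two cones, each spanned by a
  -- `ℤ`-basis and meeting along the ray of `2 + ω`.
  rcases le_total (2 * w.im) w.re with h | h
  · have hc : w = combination ⟨1, 0⟩ ⟨2, 1⟩ ((w.re - 2 * w.im).toNat, w.im.toNat) := by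
      ext <;> simp only [combination] <;> omega
    rw [hc]
    refine partitionCount_ne_of_cone (by norm_num) (by norm_num) (by decide) (by decide)
      [11] (by decide) 6 4 [(1, 3), (2, 2), (4, 1)] (by decide +kernel) (by decide +kernel)
      _ ?_ m hm
    simp only [ne_eq, Prod.mk_eq_zero]
    omega
  · have hc : w = combination ⟨2, 1⟩ ⟨3, 2⟩
        ((2 * w.re - 3 * w.im).toNat, (2 * w.im - w.re).toNat) := by
      ext <;> simp only [combination] <;> omega
    rw [hc]
    refine partitionCount_ne_of_cone (by norm_num) (by norm_num) (by decide) (by decide)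
      [11] (by decide) 4 4 [(1, 3), (2, 2), (3, 1)] (by decide +kernel) (by decide +kernel)
      _ ?_ m hm
    simp only [ne_eq, Prod.mk_eq_zero]
    omega

lemma partitionCount_ne_twentyOne (v : QuadraticAlgebra ℤ 5 1) (hv : IsPos v) :
    ∀ m ∈ ([11] : List ℕ), partitionCount v ≠ m := by
  intro m hm
  obtain ⟨w, hw, him, htr, hp⟩ := exists_reduced (by norm_num)
    (show IsPos (⟨3, -1⟩ : QuadraticAlgebra ℤ 5 1) by decide)
    (show IsPos (⟨2, 1⟩ : QuadraticAlgebra ℤ 5 1) by decide) (by decide) v hv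
  have h0 := hw.1
  simp only [trace_def, re_mul, im_mul] at htr h0
  have hc : w = combination ⟨1, 0⟩ ⟨2, 1⟩ ((w.re - 2 * w.im).toNat, w.im.toNat) := by
    ext <;> simp only [combination] <;> omega
  rw [← hp, hc]
  refine partitionCount_ne_of_cone (by norm_num) (by norm_num) (by decide) (by decide)
    [11] (by decide) 6 6 [(1, 4), (2, 3), (3, 2), (4, 1)] (by decide +kernel)
    (by decide +kernel) _ ?_ m hm
  simp only [ne_eq, Prod.mk_eq_zero]
  omega

end Exceptional

/-! ### Elements with a prescribed number of partitions. -/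

section Existence

variable {n : ℤ}

lemma exists_partitionCount_zero {c : ℤ} (hc : 0 < c) (hcn : c ^ 2 ≤ n) {k m : ℕ}
    (hk : k ≤ 2 * c + 1)
    (hkm : (k, m) ∈ [(1, 1), (2, 2), (3, 3), (4, 5), (5, 7), (6, 11)]) :
    ∃ v : QuadraticAlgebra ℤ n 0, IsPos v ∧ partitionCount v = m := by
  have hn : 0 < n := lt_of_lt_of_le (by positivity) hcn
  have h0 : 0 < k := by
    rcases Nat.eq_zero_or_pos k with rfl | h
    · simp at hkm
    · exact h
  refine ⟨⟨k, 0⟩, ?_, ?_⟩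
  · rw [isPos_iff]
    constructor <;> simp [h0]
  · rw [partitionCount_rational hn k (im_eq_zero_of_isPos_sub_zero hc hcn hk),
      countSums_rationalParts n 0 _ hkm]

lemma exists_partitionCount_one {c : ℤ} (hc : 0 < c) (hodd : Odd c) (hcn : c ^ 2 ≤ 1 + 4 * n)
    (hn : 0 < n) {k m : ℕ} (hk : k ≤ c + 1)
    (hkm : (k, m) ∈ [(1, 1), (2, 2), (3, 3), (4, 5), (5, 7), (6, 11)]) :
    ∃ v : QuadraticAlgebra ℤ n 1, IsPos v ∧ partitionCount v = m := by
  have h0 : 0 < k := by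
    rcases Nat.eq_zero_or_pos k with rfl | h
    · simp at hkm
    · exact h
  refine ⟨⟨k, 0⟩, ?_, ?_⟩
  · rw [isPos_iff]
    constructor <;> simp [h0]
  · rw [partitionCount_rational hn k (im_eq_zero_of_isPos_sub_one hc hodd hcn hk),
      countSums_rationalParts n 1 _ hkm]

lemma exists_partitionCount_of_computeCount {n t : ℤ} (hn : 0 < n) (ht : t = 0 ∨ t = 1)
    (v : QuadraticAlgebra ℤ n t) {m : ℕ} (h : IsPos v ∧ computeCount v = m) :
    ∃ v : QuadraticAlgebra ℤ n t, IsPos v ∧ partitionCount v = m :=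
  ⟨v, h.1, by rw [partitionCount_eq_computeCount hn ht, h.2]⟩

end Existence

/-! ### From the ring of integers of `ℚ(√D)` to `ℤ[ω]`. -/

section Field

open QuadraticAlgebra

variable {D : ℕ}

/-- The map `x + y * ω ↦ x + y * w` into the ring of integers. -/
noncomputable def toIntegers {K : Type*} [Field K] (n t : ℤ) (w : 𝓞 K) :
    QuadraticAlgebra ℤ n t →+ 𝓞 K where
  toFun v := v.re + v.im * w
  map_zero' := by simp
  map_add' v v' := by simp only [re_add, im_add]; push_cast; ring

lemma map_toIntegers {K : Type*} [Field K] {n t : ℤ} (w : 𝓞 K) (v : QuadraticAlgebra ℤ n t)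
    (σ : K →+* ℝ) : σ (toIntegers n t w v : K) = v.re + v.im * σ (w : K) := by
  simp [toIntegers]

lemma totallyPositive_toIntegers {K : Type*} [Field K] {n t : ℤ} {w : 𝓞 K}
    (hw : w ^ 2 = n + t * w) (σ τ : K →+* ℝ) (hστ : τ (w : K) = t - σ (w : K))
    (v : QuadraticAlgebra ℤ n t) : TotallyPositive (toIntegers n t w v) ↔ IsPos v := by
  have hquad : ∀ ρ : K →+* ℝ, ρ (w : K) ^ 2 = n + t * ρ (w : K) := by
    intro ρ
    have := congrArg (fun z : 𝓞 K => ρ (z : K)) hw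
    simpa using this
  have hσ := hquad σ
  have htr : ((trace v : ℤ) : ℝ) = (v.re + v.im * σ (w : K)) + (v.re + v.im * τ (w : K)) := by
    rw [trace_def, hστ]; push_cast; ring
  have hno : ((QuadraticAlgebra.norm v : ℤ) : ℝ) =
      (v.re + v.im * σ (w : K)) * (v.re + v.im * τ (w : K)) := by
    rw [norm_def, hστ]; push_cast; linear_combination (v.im : ℝ) ^ 2 * hσ
  have hpos : IsPos v ↔ 0 < v.re + v.im * σ (w : K) ∧ 0 < v.re + v.im * τ (w : K) := by
    rw [IsPos, ← Int.cast_pos (R := ℝ), ← Int.cast_pos (R := ℝ), htr, hno]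
    constructor
    · rintro ⟨h1, h2⟩
      rcases pos_and_pos_or_neg_and_neg_of_mul_pos h2 with h | h
      · exact h
      · linarith [h.1, h.2]
    · rintro ⟨h1, h2⟩
      exact ⟨add_pos h1 h2, mul_pos h1 h2⟩
  rw [hpos]
  constructor
  · intro h
    have h1 := h σ
    have h2 := h τ
    rw [map_toIntegers] at h1 h2
    exact ⟨h1, h2⟩
  · rintro ⟨h1, h2⟩ ρ
    rw [map_toIntegers]
    -- Every embedding sends `w` to a root of the same quadratic, whose roots are `σ w` and `τ w`.
    have : (ρ (w : K) - σ (w : K)) * (ρ (w : K) - τ (w : K)) = 0 := by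
      rw [hστ]; linear_combination hquad ρ - hσ
    rcases mul_eq_zero.1 this with h | h
    · rwa [sub_eq_zero.1 h]
    · rwa [sub_eq_zero.1 h]

lemma exists_partitionFunction_iff {K : Type*} [Field K] {n t : ℤ} {w : 𝓞 K}
    (hw : w ^ 2 = n + t * w) (σ τ : K →+* ℝ) (hστ : τ (w : K) = t - σ (w : K))
    (hirr : Irrational (σ (w : K))) (hsurj : ∀ z : 𝓞 K, ∃ x y : ℤ, z = x + y * w) (m : ℕ∞) :
    (∃ α : 𝓞 K, TotallyPositive α ∧ partitionFunction α = m) ↔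
      ∃ v : QuadraticAlgebra ℤ n t, IsPos v ∧ partitionCount v = m := by
  have hbij : Function.Bijective (toIntegers n t w) := by
    refine ⟨(injective_iff_map_eq_zero _).2 fun v hv => ?_, fun z => ?_⟩
    · have h : (v.re : ℝ) + v.im * σ (w : K) = 0 := by
        rw [← map_toIntegers, hv]; simp
      have him : v.im = 0 := by
        by_contra h0
        refine (hirr.intCast_mul h0).intCast_add v.re ⟨0, ?_⟩
        rw [h, Rat.cast_zero]
      rw [him] at h
      ext
      · simpa using h
      · exact him
    · obtain ⟨x, y, rfl⟩ := hsurj z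
      exact ⟨⟨x, y⟩, rfl⟩
  have htp := totallyPositive_toIntegers hw σ τ hστ
  have hcount : ∀ v, partitionFunction (toIntegers n t w v) = partitionCount v := fun v =>
    encard_multisetsWithSum_map (A' := {b : 𝓞 K | TotallyPositive b}) (toIntegers n t w) hbij
      htp v
  constructor
  · rintro ⟨α, h1, h2⟩
    obtain ⟨v, rfl⟩ := hbij.2 α
    exact ⟨v, (htp v).1 h1, by rw [← hcount, h2]⟩
  · rintro ⟨v, h1, h2⟩
    exact ⟨toIntegers n t w v, (htp v).2 h1, by rw [hcount, h2]⟩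

lemma irrational_sqrt_of_squarefree (hD : 2 ≤ D) (hsq : Squarefree D) : Irrational (√(D : ℝ)) := by
  rw [irrational_sqrt_natCast_iff]
  rintro ⟨r, rfl⟩
  have := Nat.isUnit_iff.1 (hsq r dvd_rfl)
  subst this
  omega

/-- The square root of `D` as an element of `ℚ(√D)`. -/
noncomputable def sqrtGen (D : ℕ) : RealQuadraticField D :=
  IntermediateField.AdjoinSimple.gen ℚ (√(D : ℝ))

lemma coe_sqrtGen (D : ℕ) : (sqrtGen D : ℝ) = √(D : ℝ) := rfl

lemma sqrtGen_sq (D : ℕ) : sqrtGen D ^ 2 = D := by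
  apply Subtype.ext
  push_cast
  rw [coe_sqrtGen, Real.sq_sqrt (Nat.cast_nonneg D)]

lemma exists_eq_add_mul_sqrtGen (z : RealQuadraticField D) :
    ∃ a b : ℚ, z = a + b * sqrtGen D := by
  have hint : IsIntegral ℚ (√(D : ℝ)) :=
    ⟨Polynomial.X ^ 2 - Polynomial.C (D : ℚ), Polynomial.monic_X_pow_sub_C _ two_ne_zero, by simp⟩
  obtain ⟨z, hz⟩ := z
  suffices ∃ a b : ℚ, z = a + b * √(D : ℝ) by
    obtain ⟨a, b, h⟩ := this
    exact ⟨a, b, Subtype.ext (by push_cast; rw [coe_sqrtGen]; exact h)⟩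
  have hz' : z ∈ Algebra.adjoin ℚ {√(D : ℝ)} := by
    rw [← IntermediateField.adjoin_simple_toSubalgebra_of_isAlgebraic hint.isAlgebraic]
    exact hz
  induction hz' using Algebra.adjoin_induction with
  | mem x hx => exact ⟨0, 1, by rw [Set.mem_singleton_iff.1 hx]; simp⟩
  | algebraMap r => exact ⟨r, 0, by simp⟩
  | add x y hx hy ihx ihy =>
    have hmem : ∀ u ∈ Algebra.adjoin ℚ {√(D : ℝ)}, u ∈ RealQuadraticField D := fun u hu =>
      IntermediateField.algebra_adjoin_le_adjoin _ _ hu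
    obtain ⟨a, b, h⟩ := ihx (hmem x hx)
    obtain ⟨a', b', h'⟩ := ihy (hmem y hy)
    exact ⟨a + a', b + b', by rw [h, h']; push_cast; ring⟩
  | mul x y hx hy ihx ihy =>
    have hmem : ∀ u ∈ Algebra.adjoin ℚ {√(D : ℝ)}, u ∈ RealQuadraticField D := fun u hu =>
      IntermediateField.algebra_adjoin_le_adjoin _ _ hu
    obtain ⟨a, b, h⟩ := ihx (hmem x hx)
    obtain ⟨a', b', h'⟩ := ihy (hmem y hy)
    refine ⟨a * a' + D * (b * b'), a * b' + b * a', ?_⟩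
    have hs : √(D : ℝ) ^ 2 = D := Real.sq_sqrt (Nat.cast_nonneg D)
    rw [h, h']
    push_cast
    linear_combination (b * b' : ℝ) * hs

lemma exists_conjugation (hD : 2 ≤ D) (hsq : Squarefree D) :
    ∃ τ : RealQuadraticField D →+* ℝ, τ (sqrtGen D) = -√(D : ℝ) := by
  have hirr := irrational_sqrt_of_squarefree hD hsq
  have hs : √(D : ℝ) ^ 2 = D := Real.sq_sqrt (Nat.cast_nonneg D)
  have hint : IsIntegral ℚ (√(D : ℝ)) :=
    ⟨Polynomial.X ^ 2 - Polynomial.C (D : ℚ), Polynomial.monic_X_pow_sub_C _ two_ne_zero, by simp⟩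
  have hmin : minpoly ℚ (√(D : ℝ)) = Polynomial.X ^ 2 - Polynomial.C (D : ℚ) := by
    refine (minpoly.unique_of_degree_le_degree_minpoly ℚ _
      (Polynomial.monic_X_pow_sub_C _ two_ne_zero) (by simp) ?_).symm
    rw [Polynomial.degree_X_pow_sub_C two_pos]
    have h2 : 2 ≤ (minpoly ℚ (√(D : ℝ))).natDegree := by
      rw [minpoly.two_le_natDegree_iff hint]
      rintro ⟨q, hq⟩
      exact hirr ⟨q, hq⟩
    rw [Polynomial.degree_eq_natDegree (minpoly.ne_zero hint)]
    exact_mod_cast h2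
  refine ⟨((IntermediateField.algHomAdjoinIntegralEquiv ℚ hint).symm
    ⟨-√(D : ℝ), ?_⟩ : _ →ₐ[ℚ] ℝ).toRingHom, ?_⟩
  · rw [Polynomial.mem_aroots, hmin]
    exact ⟨(Polynomial.monic_X_pow_sub_C _ two_ne_zero).ne_zero, by simp⟩
  · exact IntermediateField.algHomAdjoinIntegralEquiv_symm_apply_gen ℚ hint _

/-- In lowest terms the squared denominator is coprime to the squared numerator, so it divides the
squarefree `D`. -/
lemma exists_int_of_mul_sq_eq_int (hsq : Squarefree D) {q : ℚ} {k : ℤ} (h : D * q ^ 2 = k) :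
    ∃ y : ℤ, q = y := by
  have hden : (q.den : ℚ) ≠ 0 := by exact_mod_cast q.den_nz
  have h1 : (D : ℤ) * q.num ^ 2 = k * (q.den : ℤ) ^ 2 := by
    have : (D : ℚ) * q.num ^ 2 = k * (q.den : ℚ) ^ 2 := by
      rw [← h]
      nth_rewrite 2 [← Rat.num_div_den q]
      field_simp
    exact_mod_cast this
  have hcop : IsCoprime ((q.den : ℤ) ^ 2) (q.num ^ 2) :=
    (Int.isCoprime_iff_gcd_eq_one.2 (by
      rw [Int.gcd_comm]; exact q.reduced)).pow
  have h2 : (q.den : ℤ) ^ 2 ∣ D := hcop.dvd_of_dvd_mul_right ⟨k, by rw [h1]; ring⟩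
  have h3 : q.den * q.den ∣ D := by
    rw [← sq]; exact_mod_cast h2
  have h4 := Nat.isUnit_iff.1 (hsq _ h3)
  exact ⟨q.num, (Rat.coe_int_num_of_den_eq_one h4).symm⟩

/-- The integers of `ℚ(√D)` are of the form `(A + B √D) / 2` with `A ^ 2 - D * B ^ 2` divisible
by four. -/
lemma exists_half_integers (hD : 2 ≤ D) (hsq : Squarefree D) (z : 𝓞 (RealQuadraticField D)) :
    ∃ A B N : ℤ, 2 * (z : RealQuadraticField D) = A + B * sqrtGen D ∧
      A ^ 2 - D * B ^ 2 = 4 * N := by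
  obtain ⟨τ, hτ⟩ := exists_conjugation hD hsq
  obtain ⟨a, b, hab⟩ := exists_eq_add_mul_sqrtGen (z : RealQuadraticField D)
  have hs : √(D : ℝ) ^ 2 = D := Real.sq_sqrt (Nat.cast_nonneg D)
  have hz : IsIntegral ℤ (z : RealQuadraticField D) := z.2
  have h1 : IsIntegral ℤ ((z : RealQuadraticField D) : ℝ) :=
    hz.map (RealQuadraticField D).val.toRingHom.toIntAlgHom
  have h2 : IsIntegral ℤ (τ z) := hz.map τ.toIntAlgHom
  have e1 : ((z : RealQuadraticField D) : ℝ) = a + b * √(D : ℝ) := by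
    rw [hab]; push_cast; rw [coe_sqrtGen]
  have e2 : τ z = a - b * √(D : ℝ) := by
    rw [hab, map_add, map_mul, hτ, map_ratCast, map_ratCast]; ring
  have toInt : ∀ q : ℚ, IsIntegral ℤ (q : ℝ) → ∃ k : ℤ, q = k := by
    intro q hq
    have : IsIntegral ℤ q :=
      (isIntegral_algebraMap_iff (algebraMap ℚ ℝ).injective).1 (by simpa using hq)
    obtain ⟨k, hk⟩ := IsIntegrallyClosed.isIntegral_iff.1 this
    exact ⟨k, by simpa using hk.symm⟩
  -- The trace `2 * a` and the norm `a ^ 2 - D * b ^ 2` are rational and integral; hence `D * (2 *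
  -- b) ^ 2` is an integer too.
  obtain ⟨A, hA⟩ := toInt (2 * a) (by
    have := h1.add h2
    rw [e1, e2] at this
    rw [add_add_sub_cancel, ← two_mul] at this
    simpa using this)
  obtain ⟨N, hN⟩ := toInt (a ^ 2 - D * b ^ 2) (by
    have := h1.mul h2
    rw [e1, e2] at this
    have e : ((a ^ 2 - D * b ^ 2 : ℚ) : ℝ) = (a + b * √(D : ℝ)) * (a - b * √(D : ℝ)) := by
      push_cast; linear_combination (b : ℝ) ^ 2 * hs
    rwa [e])
  obtain ⟨B, hB⟩ := exists_int_of_mul_sq_eq_int hsq (q := 2 * b) (k := A ^ 2 - 4 * N) (by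
    push_cast; rw [← hA, ← hN]; ring)
  refine ⟨A, B, N, ?_, ?_⟩
  · have hA' : (2 : RealQuadraticField D) * a = A := by exact_mod_cast congrArg (Rat.cast) hA
    have hB' : (2 : RealQuadraticField D) * b = B := by exact_mod_cast congrArg (Rat.cast) hB
    rw [hab, ← hA', ← hB']; ring
  · have : (A : ℚ) ^ 2 - D * (B : ℚ) ^ 2 = 4 * N := by rw [← hA, ← hB, ← hN]; ring
    exact_mod_cast this

lemma exists_partitionFunction_iff_zero (hD : 2 ≤ D) (hsq : Squarefree D) (hmod : D % 4 ≠ 1)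
    (m : ℕ∞) :
    (∃ α : 𝓞 (RealQuadraticField D), TotallyPositive α ∧ partitionFunction α = m) ↔
      ∃ v : QuadraticAlgebra ℤ D 0, IsPos v ∧ partitionCount v = m := by
  obtain ⟨τ, hτ⟩ := exists_conjugation hD hsq
  have hint : IsIntegral ℤ (sqrtGen D) :=
    ⟨Polynomial.X ^ 2 - Polynomial.C (D : ℤ), Polynomial.monic_X_pow_sub_C _ two_ne_zero,
      by simp [sqrtGen_sq]⟩
  obtain ⟨w, hwK⟩ : ∃ w : 𝓞 (RealQuadraticField D), (w : RealQuadraticField D) = sqrtGen D :=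
    ⟨⟨_, hint⟩, rfl⟩
  refine exists_partitionFunction_iff (w := w) ?_
    (RealQuadraticField D).val.toRingHom τ ?_ ?_ ?_ m
  · apply NumberField.RingOfIntegers.ext
    simp [hwK, sqrtGen_sq]
  · rw [hwK, hτ, Int.cast_zero, zero_sub]
    rfl
  · rw [hwK]
    exact irrational_sqrt_of_squarefree hD hsq
  · intro z
    obtain ⟨A, B, N, h, hN⟩ := exists_half_integers hD hsq z
    have h4 : D % 4 ≠ 0 := fun h => by
      have := Nat.isUnit_iff.1 (hsq 2 (Nat.dvd_of_mod_eq_zero h))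
      omega
    -- For `D` congruent to 2 or 3 modulo 4, `A ^ 2 - D * B ^ 2` is divisible by 4 only if both are
    -- even.
    have hAB : (2 : ℤ) ∣ A ∧ (2 : ℤ) ∣ B := by
      have hA := Int.emod_two_eq_zero_or_one A
      have hB := Int.emod_two_eq_zero_or_one B
      obtain ⟨d, hd⟩ : ∃ d : ℤ, (D : ℤ) = 4 * d + 2 ∨ (D : ℤ) = 4 * d + 3 :=
        ⟨D / 4, by omega⟩
      rw [Int.dvd_iff_emod_eq_zero, Int.dvd_iff_emod_eq_zero]
      obtain ⟨x, hx⟩ : ∃ x, A = 2 * x ∨ A = 2 * x + 1 := ⟨A / 2, by omega⟩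
      obtain ⟨y, hy⟩ : ∃ y, B = 2 * y ∨ B = 2 * y + 1 := ⟨B / 2, by omega⟩
      rcases hd with hd | hd <;> rcases hx with rfl | rfl <;> rcases hy with rfl | rfl <;>
        rw [hd] at hN <;> ring_nf at hN <;> omega
    obtain ⟨⟨x, rfl⟩, ⟨y, rfl⟩⟩ := hAB
    refine ⟨x, y, NumberField.RingOfIntegers.ext ?_⟩
    have h2 : (2 : RealQuadraticField D) ≠ 0 := two_ne_zero
    apply mul_left_cancel₀ h2
    rw [h]
    simp only [map_add, map_mul, map_intCast, hwK]
    push_cast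
    ring

lemma exists_partitionFunction_iff_one (hD : 2 ≤ D) (hsq : Squarefree D) {n : ℤ}
    (hn : (D : ℤ) = 4 * n + 1) (m : ℕ∞) :
    (∃ α : 𝓞 (RealQuadraticField D), TotallyPositive α ∧ partitionFunction α = m) ↔
      ∃ v : QuadraticAlgebra ℤ n 1, IsPos v ∧ partitionCount v = m := by
  obtain ⟨τ, hτ⟩ := exists_conjugation hD hsq
  have hDK : (D : RealQuadraticField D) = 4 * n + 1 := by exact_mod_cast congrArg Int.cast hn
  have hs := sqrtGen_sq D
  have hw : ((1 + sqrtGen D) / 2) ^ 2 = n + (1 + sqrtGen D) / 2 := by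
    linear_combination hs / 4 + hDK / 4
  have hint : IsIntegral ℤ ((1 + sqrtGen D) / 2) := by
    refine ⟨Polynomial.X ^ 2 - (Polynomial.X + Polynomial.C n), ?_, ?_⟩
    · exact Polynomial.monic_X_pow_sub (by
        rw [Polynomial.degree_X_add_C]; norm_num)
    · simp only [Polynomial.eval₂_sub, Polynomial.eval₂_add, Polynomial.eval₂_pow,
        Polynomial.eval₂_X, Polynomial.eval₂_C]
      rw [hw]
      simp
      ring
  obtain ⟨w, hwK⟩ : ∃ w : 𝓞 (RealQuadraticField D),
      (w : RealQuadraticField D) = (1 + sqrtGen D) / 2 := ⟨⟨_, hint⟩, rfl⟩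
  have hval : (RealQuadraticField D).val.toRingHom ((1 + sqrtGen D) / 2) = (1 + √(D : ℝ)) / 2 := by
    rw [map_div₀, map_add, map_one, map_ofNat]
    rfl
  refine exists_partitionFunction_iff (w := w) ?_
    (RealQuadraticField D).val.toRingHom τ ?_ ?_ ?_ m
  · apply NumberField.RingOfIntegers.ext
    simpa [hwK] using hw
  · rw [hwK, hval, map_div₀, map_add, map_one, map_ofNat, hτ]
    push_cast
    ring
  · rw [hwK, hval]
    have := (irrational_sqrt_of_squarefree hD hsq).natCast_add 1
    simpa using this.div_natCast (two_ne_zero (α := ℕ))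
  · intro z
    obtain ⟨A, B, N, h, hN⟩ := exists_half_integers hD hsq z
    have hAB : (2 : ℤ) ∣ A - B := by
      rw [Int.dvd_iff_emod_eq_zero]
      obtain ⟨x, hx⟩ : ∃ x, A = 2 * x ∨ A = 2 * x + 1 := ⟨A / 2, by omega⟩
      obtain ⟨y, hy⟩ : ∃ y, B = 2 * y ∨ B = 2 * y + 1 := ⟨B / 2, by omega⟩
      rcases hx with rfl | rfl <;> rcases hy with rfl | rfl <;>
        rw [hn] at hN <;> ring_nf at hN <;> omega
    obtain ⟨x, hx⟩ := hAB
    obtain rfl : A = 2 * x + B := by linarith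
    refine ⟨x, B, NumberField.RingOfIntegers.ext ?_⟩
    have h2 : (2 : RealQuadraticField D) ≠ 0 := two_ne_zero
    apply mul_left_cancel₀ h2
    rw [h]
    simp only [map_add, map_mul, map_intCast, hwK]
    push_cast
    ring

end Field

/-! ### Determination of the sets `𝒟(m)`. -/

section Radicands

variable {D : ℕ}

lemma mem_missingRadicands_of_zero {m : ℕ} (hD : 2 ≤ D) (hsq : Squarefree D) (hmod : D % 4 ≠ 1)
    (h : ∀ v : QuadraticAlgebra ℤ D 0, IsPos v → partitionCount v ≠ m) :
    D ∈ missingRadicands m := by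
  refine ⟨hD, hsq, ?_⟩
  rw [exists_partitionFunction_iff_zero hD hsq hmod]
  rintro ⟨v, hv, hm⟩
  exact h v hv hm

lemma mem_missingRadicands_of_one {m : ℕ} (hD : 2 ≤ D) (hsq : Squarefree D) {n : ℤ}
    (hn : (D : ℤ) = 4 * n + 1)
    (h : ∀ v : QuadraticAlgebra ℤ n 1, IsPos v → partitionCount v ≠ m) :
    D ∈ missingRadicands m := by
  refine ⟨hD, hsq, ?_⟩
  rw [exists_partitionFunction_iff_one hD hsq hn]
  rintro ⟨v, hv, hm⟩
  exact h v hv hm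

lemma notMem_missingRadicands_of_zero {m : ℕ} (hD : 2 ≤ D) (hsq : Squarefree D)
    (hmod : D % 4 ≠ 1) (h : ∃ v : QuadraticAlgebra ℤ D 0, IsPos v ∧ partitionCount v = m) :
    D ∉ missingRadicands m := by
  intro hmem
  exact hmem.2.2 ((exists_partitionFunction_iff_zero hD hsq hmod m).2 h)

lemma notMem_missingRadicands_of_one {m : ℕ} (hD : 2 ≤ D) (hsq : Squarefree D) {n : ℤ}
    (hn : (D : ℤ) = 4 * n + 1)
    (h : ∃ v : QuadraticAlgebra ℤ n 1, IsPos v ∧ partitionCount v = m) :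
    D ∉ missingRadicands m := by
  intro hmem
  exact hmem.2.2 ((exists_partitionFunction_iff_one hD hsq hn m).2 h)

/-- A rational integer `k` has only rational partitions as soon as `D` is large. -/
lemma notMem_missingRadicands_of_large {k m : ℕ} (c d : ℕ) (hD : 2 ≤ D) (hsq : Squarefree D)
    (hkm : (k, m) ∈ [(1, 1), (2, 2), (3, 3), (4, 5), (5, 7), (6, 11)])
    (hc : 0 < c) (hkc : k ≤ 2 * c + 1) (hcD : D % 4 ≠ 1 → c ^ 2 ≤ D)
    (hd : Odd d) (hkd : k ≤ d + 1) (hdD : D % 4 = 1 → d ^ 2 ≤ D) :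
    D ∉ missingRadicands m := by
  by_cases hmod : D % 4 = 1
  · have hn : (D : ℤ) = 4 * (D / 4 : ℤ) + 1 := by omega
    refine notMem_missingRadicands_of_one hD hsq hn
      (exists_partitionCount_one (c := d) (by exact_mod_cast hd.pos) (by exact_mod_cast hd) ?_
        (by omega) (by exact_mod_cast hkd) hkm)
    have h : ((d ^ 2 : ℕ) : ℤ) ≤ D := by exact_mod_cast hdD hmod
    push_cast at h
    linarith
  · exact notMem_missingRadicands_of_zero hD hsq hmod
      (exists_partitionCount_zero (c := c) (by exact_mod_cast hc) (by exact_mod_cast hcD hmod)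
        (by exact_mod_cast hkc) hkm)

lemma not_squarefree_of_sq_dvd (r : ℕ) (hr : r ≠ 1) (h : r * r ∣ D) : ¬ Squarefree D :=
  fun hsq => hr (Nat.isUnit_iff.1 (hsq r h))

lemma Squarefree.mod_four_ne_zero (hsq : Squarefree D) : D % 4 ≠ 0 := fun h =>
  not_squarefree_of_sq_dvd 2 (by norm_num) (Nat.dvd_of_mod_eq_zero h) hsq

lemma notMem_missingRadicands_seven_of_one {n : ℤ} (hn : n ∈ [(3 : ℤ), 4, 5]) (hD : 2 ≤ D)
    (hsq : Squarefree D) (h : (D : ℤ) = 4 * n + 1) : D ∉ missingRadicands 7 := by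
  refine notMem_missingRadicands_of_one hD hsq h ?_
  simp only [List.mem_cons, List.not_mem_nil, or_false] at hn
  rcases hn with rfl | rfl | rfl <;>
    exact exists_partitionCount_of_computeCount (by norm_num) (by norm_num) ⟨5, 1⟩
      (by decide +kernel)

lemma squarefree_small : ∀ D ∈ [2, 3, 5, 6, 7, 13, 21], Squarefree D := by
  simp only [List.forall_mem_cons, List.not_mem_nil, false_imp_iff, implies_true, and_true]
  refine ⟨?_, ?_, ?_, ?_, ?_, ?_, ?_⟩ <;> decide +kernel

lemma missingRadicands_one : missingRadicands 1 = ∅ := by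
  refine Set.eq_empty_of_forall_notMem fun D hmem => ?_
  obtain ⟨hD, hsq, -⟩ := id hmem
  exact notMem_missingRadicands_of_large (k := 1) 1 1 hD hsq (by simp) (by norm_num)
    (by norm_num) (by omega) (by decide) (by norm_num) (by omega) hmem

lemma missingRadicands_two : missingRadicands 2 = ∅ := by
  refine Set.eq_empty_of_forall_notMem fun D hmem => ?_
  obtain ⟨hD, hsq, -⟩ := id hmem
  exact notMem_missingRadicands_of_large (k := 2) 1 1 hD hsq (by simp) (by norm_num)
    (by norm_num) (by omega) (by decide) (by norm_num) (by omega) hmem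

lemma missingRadicands_three : missingRadicands 3 = {5} := by
  refine Set.Subset.antisymm (fun D hmem => ?_) ?_
  · obtain ⟨hD, hsq, -⟩ := id hmem
    by_contra h5
    rw [Set.mem_singleton_iff] at h5
    exact notMem_missingRadicands_of_large (k := 3) 1 3 hD hsq (by simp) (by norm_num)
      (by norm_num) (by omega) (by decide) (by norm_num) (by omega) hmem
  · rw [Set.singleton_subset_iff]
    exact mem_missingRadicands_of_one (by norm_num) (squarefree_small _ (by simp)) (n := 1)
      (by norm_num) fun v hv => partitionCount_ne_five v hv 3 (by simp)

lemma missingRadicands_five : missingRadicands 5 = {2, 3, 5} := by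
  refine Set.Subset.antisymm (fun D hmem => ?_) ?_
  · obtain ⟨hD, hsq, -⟩ := id hmem
    by_contra h5
    simp only [Set.mem_insert_iff, Set.mem_singleton_iff, not_or] at h5
    have h4 := hsq.mod_four_ne_zero
    exact notMem_missingRadicands_of_large (k := 4) 2 3 hD hsq (by simp) (by norm_num)
      (by norm_num) (by omega) (by decide) (by norm_num) (by omega) hmem
  · rintro D (rfl | rfl | rfl)
    · exact mem_missingRadicands_of_zero (by norm_num) (squarefree_small _ (by simp))
        (by norm_num) fun v hv => partitionCount_ne_two v hv 5 (by simp)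
    · exact mem_missingRadicands_of_zero (by norm_num) (squarefree_small _ (by simp))
        (by norm_num) fun v hv => partitionCount_ne_three v hv 5 (by simp)
    · exact mem_missingRadicands_of_one (by norm_num) (squarefree_small _ (by simp)) (n := 1)
        (by norm_num) fun v hv => partitionCount_ne_five v hv 5 (by simp)

lemma missingRadicands_seven : missingRadicands 7 = {2, 5} := by
  refine Set.Subset.antisymm (fun D hmem => ?_) ?_
  · obtain ⟨hD, hsq, -⟩ := id hmem
    by_contra h5
    simp only [Set.mem_insert_iff, Set.mem_singleton_iff, not_or] at h5
    have h4 := hsq.mod_four_ne_zero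
    have h9 : D ≠ 9 := by
      rintro rfl
      exact not_squarefree_of_sq_dvd 3 (by norm_num) (by norm_num) hsq
    by_cases h3 : D = 3
    · subst h3
      exact notMem_missingRadicands_of_zero hD hsq (by norm_num)
        -- The integer 5 itself fails here, since `5 = (2 + √3) + (3 - √3)` is an extra partition;
        -- `5 + √3` has exactly 7.
        (exists_partitionCount_of_computeCount (by norm_num) (by norm_num) ⟨5, 1⟩
          (by decide +kernel)) hmem
    -- What remains below 25 is 13, 17 and 21, where `5 = (5 + √D) / 2 + (5 - √D) / 2` rules out
    -- using 5.
    by_cases hmod : D % 4 = 1 ∧ D < 25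
    · exact notMem_missingRadicands_seven_of_one (n := (D / 4 : ℤ))
        (by simp only [List.mem_cons, List.not_mem_nil, or_false]; omega) hD hsq (by omega) hmem
    · exact notMem_missingRadicands_of_large (k := 5) 2 5 hD hsq (by simp) (by norm_num)
        (by norm_num) (by omega) (by decide) (by norm_num) (by omega) hmem
  · rintro D (rfl | rfl)
    · exact mem_missingRadicands_of_zero (by norm_num) (squarefree_small _ (by simp))
        (by norm_num) fun v hv => partitionCount_ne_two v hv 7 (by simp)
    · exact mem_missingRadicands_of_one (by norm_num) (squarefree_small _ (by simp)) (n := 1)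
        (by norm_num) fun v hv => partitionCount_ne_five v hv 7 (by simp)

lemma missingRadicands_eleven : missingRadicands 11 = {2, 3, 5, 6, 7, 13, 21} := by
  refine Set.Subset.antisymm (fun D hmem => ?_) ?_
  · obtain ⟨hD, hsq, -⟩ := id hmem
    by_contra h5
    simp only [Set.mem_insert_iff, Set.mem_singleton_iff, not_or] at h5
    have h4 := hsq.mod_four_ne_zero
    have h9 : D ≠ 9 := by
      rintro rfl
      exact not_squarefree_of_sq_dvd 3 (by norm_num) (by norm_num) hsq
    -- For `D = 17` the integer 6 has irrational partitions such as `(5 + √17) / 2 + (7 - √17) / 2`,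
    -- so `11 + 6 * ω` is used instead.
    by_cases h17 : D = 17
    · subst h17
      exact notMem_missingRadicands_of_one hD hsq (n := 4) (by norm_num)
        (exists_partitionCount_of_computeCount (by norm_num) (by norm_num) ⟨11, 6⟩
          (by decide +kernel)) hmem
    · exact notMem_missingRadicands_of_large (k := 6) 3 5 hD hsq (by simp) (by norm_num)
        (by norm_num) (by omega) (by decide) (by norm_num) (by omega) hmem
  · rintro D (rfl | rfl | rfl | rfl | rfl | rfl | rfl)
    · exact mem_missingRadicands_of_zero (by norm_num) (squarefree_small _ (by simp))
        (by norm_num) fun v hv => partitionCount_ne_two v hv 11 (by simp)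
    · exact mem_missingRadicands_of_zero (by norm_num) (squarefree_small _ (by simp))
        (by norm_num) fun v hv => partitionCount_ne_three v hv 11 (by simp)
    · exact mem_missingRadicands_of_one (by norm_num) (squarefree_small _ (by simp)) (n := 1)
        (by norm_num) fun v hv => partitionCount_ne_five v hv 11 (by simp)
    · exact mem_missingRadicands_of_zero (by norm_num) (squarefree_small _ (by simp))
        (by norm_num) fun v hv => partitionCount_ne_six v hv 11 (by simp)
    · exact mem_missingRadicands_of_zero (by norm_num) (squarefree_small _ (by simp))
        (by norm_num) fun v hv => partitionCount_ne_seven v hv 11 (by simp)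
    · exact mem_missingRadicands_of_one (by norm_num) (squarefree_small _ (by simp)) (n := 3)
        (by norm_num) fun v hv => partitionCount_ne_thirteen v hv 11 (by simp)
    · exact mem_missingRadicands_of_one (by norm_num) (squarefree_small _ (by simp)) (n := 5)
        (by norm_num) fun v hv => partitionCount_ne_twentyOne v hv 11 (by simp)

end Radicands

theorem mainTheorem1 :
    missingRadicands 1 = ∅ ∧
    missingRadicands 2 = ∅ ∧
    missingRadicands 3 = {5} ∧
    missingRadicands 5 = {2, 3, 5} ∧
    missingRadicands 7 = {2, 5} ∧
    missingRadicands 11 = {2, 3, 5, 6, 7, 13, 21} :=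
  ⟨missingRadicands_one, missingRadicands_two, missingRadicands_three, missingRadicands_five,
    missingRadicands_seven, missingRadicands_eleven⟩
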